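/- **Theorem.** Consider the network creation game with a set $V$ of $n\ge 1$ players and edge price $\alpha>0$: a strategy of player $i$ is a set $s_i\subseteq V\setminus\{i\}$ (player $i$ buys the edges $\{i,j\}$, $j\in s_i$), a strategy vector $s=(s_i)_{i\in V}$ creates the undirected graph $G_s$ on $V$ in which $u\ne v$ are adjacent iff $v\in s_u$ or $u\in s_v$, and the cost of player $i$ is $$c_i(s)=\alpha\,|s_i|+\sum_{j\in V}\operatorname{dist}_{G_s}(i,j),$$ with $\operatorname{dist}_{G_s}(i,j)=\infty$ if $i$ and $j$ lie in different components. Call $s$ a *2-coalitional Nash equilibrium* if it is a Nash equilibrium (no player $i$ can strictly decrease $c_i$ by changing only $s_i$) and, moreover, no two distinct players $i,j$ can strictly decrease $c_i+c_j$ by simultaneously changing $s_i$ and $s_j$. If $\alpha\ge 41n$ and $s$ is a 2-coalitional Nash equilibrium, then $G_s$ is a tree. -/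

import Mathlib

open scoped ENNReal

namespace NetworkCreation

/-- A strategy vector: player `i` buys one edge to each vertex of the finite set `s i`. -/
abbrev Profile (V : Type*) := V → Finset V

/-- No player buys an edge to itself; these are the legitimate strategy vectors. -/
def Profile.Valid {V : Type*} (s : Profile V) : Prop :=
  ∀ i : V, i ∉ s i

/-- The undirected graph created by `s`: distinct vertices `u`, `v` are adjacent if and only if
`u` buys the edge to `v` or `v` buys the edge to `u`. -/
def Profile.graph {V : Type*} (s : Profile V) : SimpleGraph V :=
  SimpleGraph.fromRel (fun u v => v ∈ s u)

/-- The cost `α * |s i| + ∑ j, dist (i, j)` of player `i`, with distances in the created graph;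
the distance between vertices in different components is `∞`. -/
noncomputable def cost {V : Type*} [Fintype V] (α : ℝ) (s : Profile V) (i : V) : ℝ≥0∞ :=
  ENNReal.ofReal α * ((s i).card : ℝ≥0∞) + ∑ j : V, (s.graph.edist i j : ℝ≥0∞)

/-- Nash equilibrium: no player can lower its cost by buying another set of edges. -/
def IsNash {V : Type*} [Fintype V] [DecidableEq V] (α : ℝ) (s : Profile V) : Prop :=
  s.Valid ∧ ∀ (i : V) (T : Finset V), i ∉ T →
    cost α s i ≤ cost α (Function.update s i T) i

/-- 2-coalitional Nash equilibrium: a Nash equilibrium in which, moreover, no two distinct players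
can lower the sum of their costs by simultaneously changing the sets of edges that they buy. -/
def IsTwoCoalitionalNash {V : Type*} [Fintype V] [DecidableEq V] (α : ℝ) (s : Profile V) : Prop :=
  IsNash α s ∧ ∀ (i j : V), i ≠ j → ∀ (S T : Finset V), i ∉ S → j ∉ T →
    cost α s i + cost α s j ≤
      cost α (Function.update (Function.update s i S) j T) i +
        cost α (Function.update (Function.update s i S) j T) j

end NetworkCreation

/-! Let `r` be a vertex of least distance sum and `T` a shortest-path tree from `r`. A player who
buys the edge to `r` and leaves the tree intact gets a distance sum at most `n` above the minimum,
so buying that edge can replace several purchases (`IsNash.le_of_buy_root`). Hence a player other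
than `r` buys at most one edge that does not lead to a tree child, and if `u` buys an off-tree edge,
then `u` and its parent are bought by their own parents, and the relevant subtrees have size times
depth at most `3n`.

Such a subtree cannot hang on just two bought edges `a → q → b`: by `IsNash.le_of_bottleneck` this
would force `α ≤ 14n`. So further off-tree edges end in it, and both the buyer and its parent are
branching vertices: live tree children (those with an off-tree end below them) and incident off-tree
edges number at least two together.

Pairs of players enter once: by `IsTwoCoalitionalNash.eq_of_close`, buyers are neither siblings nor
parent and child. So `m` off-tree edges, which have `m` different buyers, yield `2m` distinct
branching vertices, while counting edges in the tree of live vertices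
(`card_lt_two_mul_card_edgeFinset`) allows fewer than `2m`. Hence there are no off-tree edges. -/

namespace NetworkCreation

/-! ### Distances and graphs after a deviation -/

variable {V : Type*}

/-- A function that drops by at least one along some edge towards `a` bounds the distance
from `a`. -/
theorem edist_le_of_potential {G : SimpleGraph V} {a : V} (f : V → ℕ)
    (h : ∀ z, z ≠ a → G.edist a z ≤ f z ∨ ∃ y, G.Adj y z ∧ f y + 1 ≤ f z) (z : V) :
    G.edist a z ≤ f z := by
  induction hn : f z using Nat.strong_induction_on generalizing z with
  | _ n ih =>
    subst hn
    by_cases hz : z = a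
    · subst hz; simp
    · rcases h z hz with h1 | ⟨y, hy, hf⟩
      · exact h1
      · calc G.edist a z ≤ G.edist a y + G.edist y z := SimpleGraph.edist_triangle
          _ ≤ (f y : ℕ∞) + 1 :=
            add_le_add (ih _ (by omega) y rfl) (SimpleGraph.edist_eq_one_iff_adj.2 hy).le
          _ ≤ (f z : ℕ∞) := by exact_mod_cast hf

theorem exists_adj_dist_succ {G : SimpleGraph V} (hG : G.Connected) {a z : V} (hz : z ≠ a) :
    ∃ y, G.Adj y z ∧ G.dist a y + 1 = G.dist a z := by
  obtain ⟨p, hp⟩ := hG.exists_walk_length_eq_dist z a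
  cases p with
  | nil => exact absurd rfl hz
  | cons h q =>
    rename_i y
    refine ⟨y, h.symm, ?_⟩
    have h1 : G.dist y a ≤ q.length := G.dist_le q
    have h2 : G.dist z a ≤ G.dist z y + G.dist y a := hG.dist_triangle
    have h3 : G.dist z y = 1 := SimpleGraph.dist_eq_one_iff_adj.2 h
    rw [SimpleGraph.Walk.length_cons] at hp
    rw [G.dist_comm (u := a) (v := y), G.dist_comm (u := a) (v := z)]
    omega

theorem dist_le_succ_of_adj {G : SimpleGraph V} (hG : G.Connected) (a : V) {y z : V}
    (h : G.Adj y z) : G.dist a z ≤ G.dist a y + 1 := by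
  have h2 : G.dist a z ≤ G.dist a y + G.dist y z := hG.dist_triangle
  rwa [SimpleGraph.dist_eq_one_iff_adj.2 h] at h2

theorem Profile.graph_adj {s : Profile V} {u v : V} :
    s.graph.Adj u v ↔ u ≠ v ∧ (v ∈ s u ∨ u ∈ s v) :=
  SimpleGraph.fromRel_adj _ _ _

theorem Profile.graph_adj_of_mem {s : Profile V} (hs : s.Valid) {u v : V} (h : v ∈ s u) :
    s.graph.Adj u v :=
  Profile.graph_adj.2 ⟨fun e => hs u (e ▸ h), Or.inl h⟩

section Update

variable [DecidableEq V] {s : Profile V} {i : V} {S : Finset V}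

/-- An edge survives a change of strategy unless the deviating player stops buying it. -/
theorem Profile.adj_update {x y : V} (h : s.graph.Adj x y)
    (hx : x = i → y ∈ s i → y ∈ S) (hy : y = i → x ∈ s i → x ∈ S) :
    Profile.graph (Function.update s i S) |>.Adj x y := by
  rw [Profile.graph_adj] at h ⊢
  refine ⟨h.1, ?_⟩
  rcases h.2 with h2 | h2
  · left
    by_cases e : x = i
    · subst e; rw [Function.update_self]; exact hx rfl h2
    · rwa [Function.update_of_ne e]
  · right
    by_cases e : y = i
    · subst e; rw [Function.update_self]; exact hy rfl h2
    · rwa [Function.update_of_ne e]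

theorem Profile.adj_update_self {y : V} (hi : i ∉ S) (h : y ∈ S) :
    Profile.graph (Function.update s i S) |>.Adj i y := by
  rw [Profile.graph_adj, Function.update_self]
  exact ⟨fun e => hi (e ▸ h), Or.inl h⟩

theorem Profile.adj_update_of_mem {x y : V} (hs : s.Valid) (hx : x ≠ i) (h : y ∈ s x) :
    Profile.graph (Function.update s i S) |>.Adj x y := by
  rw [Profile.graph_adj, Function.update_of_ne hx]
  exact ⟨fun e => hs x (e ▸ h), Or.inl h⟩

end Update

/-! ### Costs as real numbers -/

section Cost

variable [Fintype V] {α : ℝ} {s : Profile V}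

theorem cost_le_ofReal (hα : 0 ≤ α) {i : V} (f : V → ℕ)
    (hf : ∀ z, s.graph.edist i z ≤ f z) :
    cost α s i ≤ ENNReal.ofReal (α * (s i).card + ∑ z, (f z : ℝ)) := by
  rw [ENNReal.ofReal_add (by positivity) (by positivity), ENNReal.ofReal_mul hα,
    ENNReal.ofReal_natCast, ENNReal.ofReal_sum_of_nonneg (fun _ _ => by positivity), cost]
  refine add_le_add le_rfl (Finset.sum_le_sum fun z _ => ?_)
  rw [ENNReal.ofReal_natCast]
  simpa using ENat.toENNReal_mono (hf z)

theorem cost_eq_ofReal (hα : 0 ≤ α) (hs : s.graph.Connected) (i : V) :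
    cost α s i = ENNReal.ofReal (α * (s i).card + ∑ z, (s.graph.dist i z : ℝ)) := by
  rw [ENNReal.ofReal_add (by positivity) (by positivity), ENNReal.ofReal_mul hα,
    ENNReal.ofReal_natCast, ENNReal.ofReal_sum_of_nonneg (fun _ _ => by positivity), cost]
  congr 1
  refine Finset.sum_congr rfl fun z _ => ?_
  rw [ENNReal.ofReal_natCast, ← (hs i z).coe_dist_eq_edist, ENat.toENNReal_coe]

variable [DecidableEq V]

/-- Buying an edge to everybody has finite cost, so in equilibrium no distance is infinite. -/
theorem IsNash.connected [Nonempty V] (hα : 0 ≤ α) (hs : IsNash α s) : s.graph.Connected := by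
  obtain ⟨i⟩ := ‹Nonempty V›
  have hfin : cost α s i < ⊤ := by
    refine lt_of_le_of_lt (hs.2 i (Finset.univ.erase i) (by simp)) ?_
    refine lt_of_le_of_lt (cost_le_ofReal hα (fun _ => 1) fun z => ?_) ENNReal.ofReal_lt_top
    by_cases hz : z = i
    · subst hz; simp
    · exact_mod_cast (SimpleGraph.edist_eq_one_iff_adj.2
        (Profile.adj_update_self (by simp) (by simpa using hz))).le
  have hreach : ∀ z, s.graph.Reachable i z := fun z => by
    apply SimpleGraph.reachable_of_edist_ne_top
    intro h
    have h1 := (ENNReal.add_lt_top.1 hfin).2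
    have h2 := ENNReal.sum_lt_top.1 h1 z (Finset.mem_univ z)
    rw [h] at h2
    simp at h2
  have : Nonempty V := ⟨i⟩
  exact ⟨fun x y => (hreach x).symm.trans (hreach y)⟩

/-- The form in which the equilibrium is used: upper bounds on the distances after a deviation
suffice, and the inequality is over the reals. -/
theorem IsNash.le_of_edist_le (hα : 0 ≤ α) (hs : IsNash α s) (hc : s.graph.Connected)
    {i : V} {S : Finset V} (hi : i ∉ S) (f : V → ℕ)
    (hf : ∀ z, (Profile.graph (Function.update s i S)).edist i z ≤ f z) :
    α * (s i).card + ∑ z, (s.graph.dist i z : ℝ) ≤ α * S.card + ∑ z, (f z : ℝ) := by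
  have h := (hs.2 i S hi).trans (cost_le_ofReal hα f hf)
  rw [cost_eq_ofReal hα hc, Function.update_self] at h
  exact (ENNReal.ofReal_le_ofReal_iff (by positivity)).1 h

theorem IsTwoCoalitionalNash.le_of_edist_le (hα : 0 ≤ α) (hs : IsTwoCoalitionalNash α s)
    (hc : s.graph.Connected) {i j : V} (hij : i ≠ j) {S T : Finset V} (hi : i ∉ S) (hj : j ∉ T)
    (f g : V → ℕ)
    (hf : ∀ z, (Profile.graph (Function.update (Function.update s i S) j T)).edist i z ≤ f z)
    (hg : ∀ z, (Profile.graph (Function.update (Function.update s i S) j T)).edist j z ≤ g z) :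
    (α * (s i).card + ∑ z, (s.graph.dist i z : ℝ)) +
        (α * (s j).card + ∑ z, (s.graph.dist j z : ℝ)) ≤
      (α * S.card + ∑ z, (f z : ℝ)) + (α * T.card + ∑ z, (g z : ℝ)) := by
  have h := (hs.2 i j hij S T hi hj).trans
    (add_le_add (cost_le_ofReal hα f hf) (cost_le_ofReal hα g hg))
  rw [cost_eq_ofReal hα hc, cost_eq_ofReal hα hc, Function.update_self,
    Function.update_of_ne hij, Function.update_self,
    ← ENNReal.ofReal_add (by positivity) (by positivity),
    ← ENNReal.ofReal_add (by positivity) (by positivity)] at h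
  exact (ENNReal.ofReal_le_ofReal_iff (by positivity)).1 h

end Cost

/-! ### Shortest-path trees, descendants and off-tree edges -/

/-- A spanning tree of shortest paths from a root, given by its parent function. -/
structure ShortestPathTree (G : SimpleGraph V) where
  root : V
  par : V → V
  -- Iterating `par` beyond the root stays at the root, so descendants can be defined by iterates.
  par_root : par root = root
  adj_par : ∀ z, z ≠ root → G.Adj (par z) z
  dist_par : ∀ z, z ≠ root → G.dist root (par z) + 1 = G.dist root z

theorem ShortestPathTree.exists_root_eq {G : SimpleGraph V} (hG : G.Connected) (r : V) :
    ∃ T : ShortestPathTree G, T.root = r := by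
  classical
  have h : ∀ z, ∃ y, (z = r → y = r) ∧ (z ≠ r → G.Adj y z ∧ G.dist r y + 1 = G.dist r z) := by
    intro z
    by_cases hz : z = r
    · exact ⟨r, fun _ => rfl, fun h => absurd hz h⟩
    · obtain ⟨y, hy⟩ := exists_adj_dist_succ hG hz
      exact ⟨y, fun h => absurd h hz, fun _ => hy⟩
  choose p hp using h
  exact ⟨⟨r, p, (hp r).1 rfl, fun z hz => ((hp z).2 hz).1, fun z hz => ((hp z).2 hz).2⟩, rfl⟩

namespace ShortestPathTree

variable {G : SimpleGraph V} (T : ShortestPathTree G)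

/-- Distance from the root. -/
noncomputable def depth (z : V) : ℕ := G.dist T.root z

theorem depth_root : T.depth T.root = 0 := by simp [depth]

theorem depth_par {z : V} (hz : z ≠ T.root) : T.depth (T.par z) + 1 = T.depth z :=
  T.dist_par z hz

theorem depth_par_le (z : V) : T.depth (T.par z) ≤ T.depth z := by
  by_cases hz : z = T.root
  · rw [hz, T.par_root]
  · have := T.depth_par hz
    omega

theorem par_ne {z : V} (hz : z ≠ T.root) : T.par z ≠ z := fun h => by
  have := T.depth_par hz
  rw [h] at this
  omega

theorem depth_le_of_adj (hG : G.Connected) {y z : V} (h : G.Adj y z) :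
    T.depth z ≤ T.depth y + 1 := dist_le_succ_of_adj hG _ h

theorem eq_root_of_depth (hG : G.Connected) {z : V} (h : T.depth z = 0) : z = T.root :=
  (hG.dist_eq_zero_iff.1 h).symm

theorem depth_pos (hG : G.Connected) {z : V} (h : z ≠ T.root) : 0 < T.depth z :=
  Nat.pos_of_ne_zero fun h0 => h (T.eq_root_of_depth hG h0)

/-- The edges of `G` outside the tree. -/
def offTree : SimpleGraph V where
  Adj x y := G.Adj x y ∧ T.par x ≠ y ∧ T.par y ≠ x
  symm := ⟨fun _ _ h => ⟨h.1.symm, h.2.2, h.2.1⟩⟩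
  loopless := ⟨fun x h => G.loopless.1 x h.1⟩

theorem offTree_ne_root (hG : G.Connected) {x y : V} (h : T.offTree.Adj x y) : x ≠ T.root := by
  rintro rfl
  have h1 := T.depth_le_of_adj hG h.1
  have hy : y ≠ T.root := h.1.ne'
  have h2 := T.depth_par hy
  rw [T.depth_root] at h1
  exact h.2.2 (T.eq_root_of_depth hG (by omega))

section Descendants

variable [Fintype V]

open Classical in
/-- The vertices of the subtree hanging from `v`, including `v`. -/
noncomputable def desc (v : V) : Finset V := {z | ∃ k, T.par^[k] z = v}

variable {T} {v w z : V}

theorem mem_desc : z ∈ T.desc v ↔ ∃ k, T.par^[k] z = v := by simp [desc]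

theorem self_mem_desc : v ∈ T.desc v := mem_desc.2 ⟨0, rfl⟩

theorem mem_desc_of_par_mem (h : T.par z ∈ T.desc v) : z ∈ T.desc v := by
  obtain ⟨k, hk⟩ := mem_desc.1 h
  exact mem_desc.2 ⟨k + 1, hk⟩

theorem par_mem_desc (h : z ∈ T.desc v) (hz : z ≠ v) : T.par z ∈ T.desc v := by
  obtain ⟨k, hk⟩ := mem_desc.1 h
  cases k with
  | zero => exact absurd hk hz
  | succ k => exact mem_desc.2 ⟨k, hk⟩

theorem mem_desc_par : z ∈ T.desc (T.par z) := mem_desc.2 ⟨1, rfl⟩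

theorem desc_trans (h : z ∈ T.desc w) (h' : w ∈ T.desc v) : z ∈ T.desc v := by
  obtain ⟨k, hk⟩ := mem_desc.1 h
  obtain ⟨l, hl⟩ := mem_desc.1 h'
  exact mem_desc.2 ⟨l + k, by rw [Function.iterate_add_apply, hk, hl]⟩

theorem depth_le_of_mem_desc (h : z ∈ T.desc v) : T.depth v ≤ T.depth z := by
  obtain ⟨k, hk⟩ := mem_desc.1 h
  induction k generalizing z with
  | zero => exact le_of_eq (by rw [← hk]; rfl)
  | succ k ih => exact (ih (mem_desc.2 ⟨k, hk⟩) hk).trans (T.depth_par_le z)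

theorem par_notMem_desc (h : v ≠ T.root) : T.par v ∉ T.desc v := fun h' => by
  have h1 := depth_le_of_mem_desc h'
  have h2 := T.depth_par h
  omega

theorem root_notMem_desc (hG : G.Connected) (h : v ≠ T.root) : T.root ∉ T.desc v := fun h' => by
  have h1 := depth_le_of_mem_desc h'
  have h2 := T.depth_pos hG h
  rw [T.depth_root] at h1
  omega

theorem mem_desc_root : z ∈ T.desc T.root := by
  induction hn : T.depth z generalizing z with
  | zero =>
    by_cases hz : z = T.root
    · rw [hz]; exact self_mem_desc
    · have := T.depth_par hz
      omega
  | succ n ih =>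
    by_cases hz : z = T.root
    · rw [hz]; exact self_mem_desc
    · have := T.depth_par hz
      exact mem_desc_of_par_mem (ih (by omega))

theorem eq_or_exists_child (h : z ∈ T.desc v) :
    z = v ∨ ∃ c, c ≠ T.root ∧ T.par c = v ∧ z ∈ T.desc c := by
  obtain ⟨k, hk⟩ := mem_desc.1 h
  induction k generalizing z with
  | zero => exact Or.inl hk
  | succ k ih =>
    rcases ih (mem_desc.2 ⟨k, hk⟩) hk with h1 | ⟨c, hc, hcv, hzc⟩
    · by_cases hz : z = T.root
      · left; rw [← h1, hz, T.par_root]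
      · exact Or.inr ⟨z, hz, h1, self_mem_desc⟩
    · exact Or.inr ⟨c, hc, hcv, mem_desc_of_par_mem hzc⟩

/-- An off-tree neighbour of `u` is not a descendant of `u`. -/
theorem notMem_desc_of_offTree (hG : G.Connected) {x : V} (h : T.offTree.Adj v x) :
    x ∉ T.desc v := fun hx => by
  have hxr := T.offTree_ne_root hG h.symm
  have h1 := par_mem_desc hx h.ne'
  have h2 := depth_le_of_mem_desc h1
  have h3 := T.depth_par hxr
  have h4 := T.depth_le_of_adj hG h.1
  -- By depth, a descendant of `v` adjacent to `v` must be a child, and the edge to a child lies in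
  -- the tree.
  rcases eq_or_exists_child h1 with h5 | ⟨c, hc, hcv, hxc⟩
  · exact h.2.2 h5
  · have h6 := depth_le_of_mem_desc hxc
    have h7 := T.depth_par hc
    rw [hcv] at h7
    omega

end Descendants

/-- Every edge then joins a non-root vertex to its parent, so there are at most `n - 1` edges. -/
theorem isTree_of_offTree_eq_bot [Fintype V] (hG : G.Connected) (h : ∀ x y, ¬ T.offTree.Adj x y) :
    G.IsTree := by
  classical
  rw [SimpleGraph.isTree_iff_connected_and_card]
  refine ⟨hG, le_antisymm ?_ hG.card_vert_le_card_edgeSet_add_one⟩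
  have hsub : G.edgeFinset ⊆ (Finset.univ.erase T.root).image fun z => s(T.par z, z) := by
    intro e
    induction e using Sym2.ind with
    | _ x y =>
      intro he
      have hxy : G.Adj x y := by simpa using he
      have key : ∀ a b, G.Adj a b → T.par a = b → a ≠ T.root := by
        rintro a b hab h1 rfl
        rw [T.par_root] at h1
        exact hab.ne h1
      by_cases h1 : T.par x = y
      · exact Finset.mem_image.2 ⟨x, by simpa using key x y hxy h1, by rw [h1, Sym2.eq_swap]⟩
      · by_cases h2 : T.par y = x
        · exact Finset.mem_image.2 ⟨y, by simpa using key y x hxy.symm h2, by rw [h2]⟩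
        · exact absurd ⟨hxy, h1, h2⟩ (h x y)
  have hcard := (Finset.card_le_card hsub).trans Finset.card_image_le
  rw [Finset.card_erase_of_mem (Finset.mem_univ _), Finset.card_univ] at hcard
  have hpos : 0 < Fintype.card V := Fintype.card_pos_iff.2 ⟨T.root⟩
  rw [Nat.card_eq_fintype_card, Nat.card_eq_fintype_card, ← SimpleGraph.edgeFinset_card]
  omega

end ShortestPathTree

end NetworkCreation

/-! ### The bottleneck inequality -/

namespace NetworkCreation

variable {V : Type*} [Fintype V] [DecidableEq V] {α : ℝ} {s : Profile V}

/-- A set `W` that is joined to the rest of the graph by the bought edges `a → q → b` only has a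
size that bounds the price, if dropping `q → b` costs player `q` at most `m` per vertex. -/
theorem IsNash.le_of_bottleneck (hα : 0 ≤ α) (hs : IsNash α s) (hc : s.graph.Connected)
    {a q b : V} {W : Finset V} (ha : a ∉ W) (hb : b ∉ W) (hq : q ∈ W) (hab : a ≠ b)
    (haq : q ∈ s a) (hqb : b ∈ s q)
    (hW : ∀ z ∈ W, ∀ y ∉ W, s.graph.Adj z y → z = q ∧ (y = a ∨ y = b)) (m : ℕ)
    (hdel : ∀ z, (Profile.graph (Function.update s q ((s q).erase b))).edist q z ≤
      (s.graph.dist q z + m : ℕ)) :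
    α ≤ 2 * Fintype.card V + 2 * (W.card * m) := by
  classical
  have haq' : a ≠ q := fun e => ha (e ▸ hq)
  have hadjaq : s.graph.Adj a q := Profile.graph_adj_of_mem hs.1 haq
  have hadjqb : s.graph.Adj q b := Profile.graph_adj_of_mem hs.1 hqb
  let G₀ : SimpleGraph V :=
    { Adj := fun x y => s.graph.Adj x y ∧ x ∉ W ∧ y ∉ W
      symm := ⟨fun _ _ h => ⟨h.1.symm, h.2.2, h.2.1⟩⟩
      loopless := ⟨fun x h => s.graph.loopless.1 x h.1⟩ }
  -- The vertices outside `W` to which every shortest path from `a` passes through `W`, that is,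
  -- runs along `a, q, b`. They come closer by one when `a` buys the edge to `b`, while those of `W`
  -- recede by at most one; so `Z` is no larger than `W`.
  let Z : Finset V := {z | z ∉ W ∧ ¬ G₀.edist a z ≤ s.graph.dist a z}
  have memZ : ∀ z, z ∈ Z ↔ z ∉ W ∧ ¬ G₀.edist a z ≤ s.graph.dist a z := fun z => by simp [Z]
  have haZ : a ∉ Z := fun h => ((memZ a).1 h).2 (by simp)
  have hdist_pos : ∀ z, z ≠ a → 0 < s.graph.dist a z := fun z hz => hc.pos_dist_of_ne hz.symm
  -- player `a` replaces `a → q` by `a → b`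
  have hZW : Z.card ≤ W.card := by
    let f : V → ℕ := fun z => if z ∈ W then s.graph.dist a z + 1 else
      if z ∈ Z then s.graph.dist a z - 1 else s.graph.dist a z
    have hfW : ∀ z, z ∈ W → f z = s.graph.dist a z + 1 := fun z h => if_pos h
    have hfZ : ∀ z, z ∉ W → z ∈ Z → f z = s.graph.dist a z - 1 := fun z h h' => by
      simp only [f, if_neg h, if_pos h']
    have hfN : ∀ z, z ∉ W → z ∉ Z → f z = s.graph.dist a z := fun z h h' => by
      simp only [f, if_neg h, if_neg h']
    let S := insert b ((s a).erase q)
    have haS : a ∉ S := by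
      simp only [S, Finset.mem_insert, Finset.mem_erase, not_or, not_and]
      exact ⟨hab, fun _ => hs.1 a⟩
    have hScard : S.card ≤ (s a).card := by
      have h1 : S.card ≤ _ := Finset.card_insert_le b ((s a).erase q)
      have h2 := Finset.card_erase_add_one haq
      omega
    have hab1 : (Profile.graph (Function.update s a S)).Adj a b :=
      Profile.adj_update_self haS (Finset.mem_insert_self _ _)
    have hbq1 : (Profile.graph (Function.update s a S)).Adj b q :=
      (Profile.adj_update_of_mem hs.1 haq'.symm hqb).symm
    have hkeep : ∀ x y, s.graph.Adj x y → x ≠ q → y ≠ q →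
        (Profile.graph (Function.update s a S)).Adj x y := fun x y hxy hx hy =>
      Profile.adj_update hxy (fun _ h => Finset.mem_insert_of_mem (Finset.mem_erase.2 ⟨hy, h⟩))
        (fun _ h => Finset.mem_insert_of_mem (Finset.mem_erase.2 ⟨hx, h⟩))
    have hkeep' : ∀ x y, s.graph.Adj x y → x ≠ a → y ≠ a →
        (Profile.graph (Function.update s a S)).Adj x y := fun x y hxy hx hy =>
      Profile.adj_update hxy (fun h => absurd h hx) (fun h => absurd h hy)
    have hf : ∀ z, (Profile.graph (Function.update s a S)).edist a z ≤ f z := by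
      refine edist_le_of_potential f fun z hz => ?_
      obtain ⟨y, hyz, hy⟩ := exists_adj_dist_succ hc hz
      by_cases hzb : z = b
      · left
        subst hzb
        rw [SimpleGraph.edist_eq_one_iff_adj.2 hab1]
        -- The bound could be `0` only if `b ∈ Z` were adjacent to `a`, but then the edge `ab` would
        -- itself be a shortest path avoiding `W`.
        have h1 : 1 ≤ f z := by
          by_cases hzZ : z ∈ Z
          · rw [hfZ z hb hzZ]
            by_contra hlt
            have h2 : s.graph.dist a z = 1 := by
              have := hdist_pos z hz
              omega
            refine ((memZ z).1 hzZ).2 ?_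
            have h3 : G₀.Adj a z := ⟨SimpleGraph.dist_eq_one_iff_adj.1 h2, ha, hb⟩
            rw [SimpleGraph.edist_eq_one_iff_adj.2 h3, h2]
            simp
          · rw [hfN z hb hzZ]
            exact hdist_pos z hz
        exact_mod_cast h1
      by_cases hzW : z ∈ W
      · by_cases hyW : y ∈ W
        · right
          refine ⟨y, hkeep' y z hyz (fun e => ha (e ▸ hyW)) hz, ?_⟩
          rw [hfW z hzW, hfW y hyW]
          omega
        · left
          -- `W` can only be entered at `q`, which is now reached along `a, b, q`.
          obtain ⟨rfl, -⟩ := hW z hzW y hyW hyz.symm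
          rw [hfW z hzW, SimpleGraph.dist_eq_one_iff_adj.2 hadjaq]
          calc _ ≤ _ := SimpleGraph.edist_triangle (v := b)
            _ = _ := by
              rw [SimpleGraph.edist_eq_one_iff_adj.2 hab1, SimpleGraph.edist_eq_one_iff_adj.2 hbq1]
              rfl
      · by_cases hyW : y ∈ W
        · rcases (hW y hyW z hzW hyz).2 with h | h
          · exact absurd h hz
          · exact absurd h hzb
        · right
          refine ⟨y, hkeep y z hyz (fun e => hyW (e ▸ hq)) (fun e => hzW (e ▸ hq)), ?_⟩
          by_cases hzZ : z ∈ Z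
          · have hyZ : y ∈ Z := by
              refine (memZ y).2 ⟨hyW, fun h => ((memZ z).1 hzZ).2 ?_⟩
              have h3 : G₀.Adj y z := ⟨hyz, hyW, hzW⟩
              calc G₀.edist a z ≤ G₀.edist a y + G₀.edist y z := SimpleGraph.edist_triangle
                _ ≤ s.graph.dist a y + 1 :=
                  add_le_add h (SimpleGraph.edist_eq_one_iff_adj.2 h3).le
                _ = s.graph.dist a z := by rw [← hy]; simp
            have := hdist_pos y (fun e => haZ (e ▸ hyZ))
            rw [hfZ z hzW hzZ, hfZ y hyW hyZ]
            omega
          · rw [hfN z hzW hzZ]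
            by_cases hyZ : y ∈ Z
            · rw [hfZ y hyW hyZ]
              omega
            · rw [hfN y hyW hyZ]
              omega
    have hnash := hs.le_of_edist_le hα hc haS f hf
    have hsum : ∑ z, f z + Z.card ≤ ∑ z, s.graph.dist a z + W.card := by
      have hpt : ∀ z ∈ Finset.univ, f z + (if z ∈ Z then 1 else 0) ≤
          s.graph.dist a z + (if z ∈ W then 1 else 0) := by
        intro z _
        by_cases hzW : z ∈ W
        · have hzZ : z ∉ Z := fun h => ((memZ z).1 h).1 hzW
          rw [hfW z hzW, if_neg hzZ, if_pos hzW]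
        · by_cases hzZ : z ∈ Z
          · have := hdist_pos z (fun e => haZ (e ▸ hzZ))
            rw [hfZ z hzW hzZ, if_pos hzZ, if_neg hzW]
            omega
          · rw [hfN z hzW hzZ, if_neg hzZ, if_neg hzW]
      have := Finset.sum_le_sum hpt
      simpa [Finset.sum_add_distrib] using this
    have hle : (∑ z, s.graph.dist a z : ℕ) ≤ ∑ z, f z := by
      have h1 : α * S.card ≤ α * (s a).card :=
        mul_le_mul_of_nonneg_left (by exact_mod_cast hScard) hα
      have h2 : (∑ z, (s.graph.dist a z : ℝ)) ≤ ∑ z, (f z : ℝ) := by linarith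
      exact_mod_cast h2
    omega
  -- player `q` drops `q → b`
  let g : V → ℕ := fun z => s.graph.dist q z + (2 + if z ∈ W ∪ Z then m else 0)
  have hqS : q ∉ (s q).erase b := fun h => hs.1 q (Finset.mem_of_mem_erase h)
  have hg : ∀ z, (Profile.graph (Function.update s q ((s q).erase b))).edist q z ≤ g z := by
    intro z
    by_cases hz : z ∈ W ∪ Z
    · refine (hdel z).trans ?_
      simp only [g, if_pos hz]
      exact_mod_cast (by omega)
    -- Here a shortest path from `a` avoids `W`, hence survives. Going from `q` over `a` costs one
    -- step, and `dist a z ≤ 1 + dist q z`: at most `2` more in all.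
    · simp only [Finset.mem_union, not_or] at hz
      have h1 : G₀.edist a z ≤ s.graph.dist a z := by
        by_contra h
        exact hz.2 ((memZ z).2 ⟨hz.1, h⟩)
      have h2 : G₀ ≤ Profile.graph (Function.update s q ((s q).erase b)) := fun x y hxy =>
        Profile.adj_update hxy.1 (fun e => absurd hq (e ▸ hxy.2.1))
          (fun e => absurd hq (e ▸ hxy.2.2))
      have h3 : (Profile.graph (Function.update s q ((s q).erase b))).Adj q a :=
        (Profile.adj_update_of_mem hs.1 haq' haq).symm
      have h4 : s.graph.dist a z ≤ 1 + s.graph.dist q z := by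
        have h5 : s.graph.dist a z ≤ s.graph.dist a q + s.graph.dist q z := hc.dist_triangle
        rwa [SimpleGraph.dist_eq_one_iff_adj.2 hadjaq] at h5
      calc _ ≤ _ := SimpleGraph.edist_triangle (v := a)
        _ ≤ (1 : ℕ∞) + s.graph.dist a z :=
          add_le_add (SimpleGraph.edist_eq_one_iff_adj.2 h3).le
            ((SimpleGraph.edist_anti h2).trans h1)
        _ ≤ g z := by
          have h6 : 1 + s.graph.dist a z ≤ g z := by simp only [g]; omega
          exact_mod_cast h6
  have hnash := hs.le_of_edist_le hα hc hqS g hg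
  have hcard : ((s q).card : ℝ) = ((s q).erase b).card + 1 := by
    exact_mod_cast (Finset.card_erase_add_one hqb).symm
  have hsum : ∑ z, g z ≤ ∑ z, s.graph.dist q z + (2 * Fintype.card V + 2 * (W.card * m)) := by
    have h1 : (W ∪ Z).card * m ≤ 2 * W.card * m :=
      Nat.mul_le_mul_right m ((Finset.card_union_le _ _).trans (by omega))
    have h2 : ∑ z, g z =
        ∑ z, s.graph.dist q z + (Fintype.card V * 2 + (W ∪ Z).card * m) := by
      simp only [g, Finset.sum_add_distrib]
      rw [Finset.sum_ite_mem]
      simp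
    rw [h2]
    nlinarith
  have hsum' : (∑ z, (g z : ℝ)) ≤
      ∑ z, (s.graph.dist q z : ℝ) + (2 * Fintype.card V + 2 * (W.card * m)) := by
    exact_mod_cast hsum
  rw [hcard] at hnash
  linarith

end NetworkCreation

/-! ### Exchanging edges for the edge to the root -/

namespace NetworkCreation

open ShortestPathTree

theorem card_insert_erase_erase_le {V : Type*} [DecidableEq V] {S : Finset V} {x y r : V}
    (hx : x ∈ S) (hy : y ∈ S) (hxy : x ≠ y) :
    (insert r ((S.erase x).erase y)).card + 1 ≤ S.card := by
  have h1 := Finset.card_insert_le r ((S.erase x).erase y)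
  have h2 := Finset.card_erase_add_one (Finset.mem_erase.2 ⟨hxy.symm, hy⟩)
  have h3 := Finset.card_erase_add_one hx
  omega

theorem card_insert_erase_le {V : Type*} [DecidableEq V] {S : Finset V} {x r : V} (hx : x ∈ S) :
    (insert r (S.erase x)).card ≤ S.card := by
  have h1 := Finset.card_insert_le r (S.erase x)
  have h3 := Finset.card_erase_add_one hx
  omega

/-- Tree edges survive if a player keeps buying the edges to its children. -/
theorem adj_par_update {V : Type*} [DecidableEq V] {s : Profile V}
    {T : ShortestPathTree s.graph} {v : V} {S : Finset V} {z : V} (hz : z ≠ T.root)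
    (hzv : z ≠ v) (hS : z ∈ s v → T.par z = v → z ∈ S) :
    (Profile.graph (Function.update s v S)).Adj (T.par z) z :=
  Profile.adj_update (T.adj_par z hz) (fun e h => hS h e) (fun e => absurd e hzv)

theorem le_of_mul_card_le {n k l : ℕ} {α B c : ℝ} (hα : 0 ≤ α) (hkl : l + 1 ≤ k)
    (hc : 0 ≤ c) (h : α * k + c ≤ α * l + B * n) : α ≤ B * n := by
  have h1 : α * ((l : ℝ) + 1) ≤ α * k :=
    mul_le_mul_of_nonneg_left (by exact_mod_cast hkl) hα
  linarith

/-- The sum of the distances from `v`. -/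
noncomputable def distSum {V : Type*} [Fintype V] (G : SimpleGraph V) (v : V) : ℝ :=
  ∑ z, (G.dist v z : ℝ)

theorem distSum_root {V : Type*} [Fintype V] {G : SimpleGraph V} (T : ShortestPathTree G) :
    distSum G T.root = ∑ z, (T.depth z : ℝ) := rfl

variable {V : Type*} [Fintype V] [DecidableEq V] {α : ℝ} {s : Profile V}
  (T : ShortestPathTree s.graph)

/-- Player `v` buys the edge to the root in exchange for other edges; the vertices of `C`, cut off
by this, reach the root in another way. -/
theorem IsNash.le_of_buy_root (hα : 0 ≤ α) (hs : IsNash α s) (hc : s.graph.Connected)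
    (hmin : ∀ v, distSum s.graph T.root ≤ distSum s.graph v) {v : V} (hv : v ≠ T.root)
    {S : Finset V} (hvS : v ∉ S) (hrS : T.root ∈ S) (C : Finset V) (hvC : v ∉ C)
    (hrC : T.root ∉ C)
    (h₁ : ∀ z ∉ C, z ≠ T.root → z ≠ v → T.par z ∉ C ∧
      (Profile.graph (Function.update s v S)).Adj (T.par z) z)
    (h₂ : ∀ z ∈ C, ∃ y, (Profile.graph (Function.update s v S)).Adj y z ∧
      ((y ∈ C ∧ T.depth y + 1 ≤ T.depth z) ∨ (y ∉ C ∧ T.depth y ≤ T.depth z + 1))) :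
    α * (s v).card + (T.desc v \ C).card * (T.depth v + 1) ≤
      α * S.card + 3 * Fintype.card V := by
  -- Outside `C`, descendants of `v` are reached down the tree and all others through the root,
  -- within `depth + 1`. A vertex `z` of `C` entered from `y ∉ C` with depth at most `depth z + 1`
  -- gets `(depth z + 2) + 1`.
  let f : V → ℕ := fun z => if z ∈ C then T.depth z + 3 else
    if z ∈ T.desc v then T.depth z - T.depth v else T.depth z + 1
  have hfC : ∀ z, z ∈ C → f z = T.depth z + 3 := fun z h => if_pos h
  have hfD : ∀ z, z ∉ C → z ∈ T.desc v → f z = T.depth z - T.depth v := fun z h h' => by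
    simp only [f, if_neg h, if_pos h']
  have hfN : ∀ z, z ∉ C → z ∉ T.desc v → f z = T.depth z + 1 := fun z h h' => by
    simp only [f, if_neg h, if_neg h']
  have hfle : ∀ z, z ∉ C → f z ≤ T.depth z + 1 := fun z h => by
    by_cases h' : z ∈ T.desc v
    · rw [hfD z h h']; omega
    · rw [hfN z h h']
  have hf : ∀ z, (Profile.graph (Function.update s v S)).edist v z ≤ f z := by
    refine edist_le_of_potential f fun z hz => ?_
    right
    by_cases hzC : z ∈ C
    · obtain ⟨y, hy, h | h⟩ := h₂ z hzC
      · refine ⟨y, hy, ?_⟩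
        rw [hfC z hzC, hfC y h.1]
        omega
      · refine ⟨y, hy, ?_⟩
        have := hfle y h.1
        rw [hfC z hzC]
        omega
    · by_cases hzr : z = T.root
      · refine ⟨v, hzr ▸ Profile.adj_update_self hvS hrS, ?_⟩
        rw [hfD v hvC self_mem_desc, hzr, hfN _ hrC (root_notMem_desc hc hv)]
        omega
      · obtain ⟨hpC, hp⟩ := h₁ z hzC hzr hz
        have hd := T.depth_par hzr
        refine ⟨_, hp, ?_⟩
        by_cases hzD : z ∈ T.desc v
        · have hpD := par_mem_desc hzD hz
          have := depth_le_of_mem_desc hpD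
          rw [hfD z hzC hzD, hfD _ hpC hpD]
          omega
        · rw [hfN z hzC hzD, hfN _ hpC fun h => hzD (mem_desc_of_par_mem h)]
          omega
  have hnash := hs.le_of_edist_le hα hc hvS f hf
  have hsum : ∑ z, f z + (T.desc v \ C).card * (T.depth v + 1) ≤
      ∑ z, T.depth z + 3 * Fintype.card V := by
    have hpt : ∀ z ∈ Finset.univ, f z + (if z ∈ T.desc v \ C then T.depth v + 1 else 0) ≤
        T.depth z + 3 := by
      intro z _
      by_cases hzC : z ∈ C
      · rw [hfC z hzC, if_neg (by simp [hzC])]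
      · by_cases hzD : z ∈ T.desc v
        · have := depth_le_of_mem_desc hzD
          rw [hfD z hzC hzD, if_pos (by simp [hzC, hzD])]
          omega
        · rw [hfN z hzC hzD, if_neg (by simp [hzD])]
          omega
    have := Finset.sum_le_sum hpt
    rw [Finset.sum_add_distrib, Finset.sum_add_distrib, Finset.sum_ite_mem] at this
    simpa [mul_comm] using this
  have hsum' : (∑ z, (f z : ℝ)) + (T.desc v \ C).card * (T.depth v + 1) ≤
      ∑ z, (T.depth z : ℝ) + 3 * Fintype.card V := by exact_mod_cast hsum
  -- Minimality of the root bounds the old distance sum of `v` below by the sum of the depths.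
  have h := hmin v
  rw [distSum_root, distSum] at h
  linarith

variable {T}

section

variable (hα : 0 ≤ α) (hα' : 14 * (Fintype.card V : ℝ) < α) (hs : IsNash α s)
  (hc : s.graph.Connected) (hmin : ∀ v, distSum s.graph T.root ≤ distSum s.graph v)
include hα hα' hs hc hmin

/-- A player buys at most one edge that does not lead to one of its children. -/
theorem IsNash.eq_of_not_child {v x y : V} (hv : v ≠ T.root) (hx : x ∈ s v) (hy : y ∈ s v)
    (hxv : T.par x ≠ v) (hyv : T.par y ≠ v) : x = y := by
  by_contra hxy
  -- Both edges are traded for the one to the root. No edge to a child is lost, so nothing is cut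
  -- off and one `α` is saved.
  have h := hs.le_of_buy_root T hα hc hmin hv (S := insert T.root (((s v).erase x).erase y))
    (by simp [hv, hs.1 v]) (Finset.mem_insert_self _ _) ∅ (by simp) (by simp)
    (fun z _ hzr hzv => ⟨by simp, adj_par_update hzr hzv fun h1 h2 =>
      Finset.mem_insert_of_mem (Finset.mem_erase.2 ⟨fun e => hyv (e ▸ h2),
        Finset.mem_erase.2 ⟨fun e => hxv (e ▸ h2), h1⟩⟩)⟩) (by simp)
  have h' := le_of_mul_card_le hα (card_insert_erase_erase_le hx hy hxy) (by positivity) h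
  have : (0 : ℝ) ≤ Fintype.card V := by positivity
  linarith

-- Trading the edge to `x` for the edge to the root leaves the number of purchases unchanged and
-- brings the whole subtree of `v` closer.
omit hα' in
theorem IsNash.card_desc_mul_le {v x : V} (hv : v ≠ T.root) (hx : x ∈ s v) (hxv : T.par x ≠ v) :
    (T.desc v).card * (T.depth v + 1) ≤ 3 * Fintype.card V := by
  have h := hs.le_of_buy_root T hα hc hmin hv (S := insert T.root ((s v).erase x))
    (by simp [hv, hs.1 v]) (Finset.mem_insert_self _ _) ∅ (by simp) (by simp)
    (fun z _ hzr hzv => ⟨by simp, adj_par_update hzr hzv fun h1 h2 =>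
      Finset.mem_insert_of_mem (Finset.mem_erase.2 ⟨fun e => hxv (e ▸ h2), h1⟩)⟩) (by simp)
  have h1 : α * ((insert T.root ((s v).erase x)).card : ℝ) ≤ α * (s v).card :=
    mul_le_mul_of_nonneg_left (by exact_mod_cast card_insert_erase_le hx) hα
  rw [Finset.sdiff_empty] at h
  have h2 : ((T.desc v).card : ℝ) * (T.depth v + 1) ≤ 3 * Fintype.card V := by linarith
  exact_mod_cast h2

/-- The buyer of an off-tree edge is not adjacent to the root in the tree. -/
theorem IsNash.par_ne_root {u x : V} (hx : x ∈ s u) (hux : T.offTree.Adj u x) :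
    T.par u ≠ T.root := by
  intro hpr
  have hur := T.offTree_ne_root hc hux
  have huS : u ∉ (s u).erase x := fun h => hs.1 u (Finset.mem_of_mem_erase h)
  have hadj : ∀ z, z ≠ T.root →
      (Profile.graph (Function.update s u ((s u).erase x))).Adj (T.par z) z := fun z hz =>
    Profile.adj_update (T.adj_par z hz)
      (fun e h => Finset.mem_erase.2 ⟨fun e' => hux.2.2 (e' ▸ e), h⟩)
      (fun e h => Finset.mem_erase.2 ⟨fun e' => hux.2.1 (by rw [← e', e]), h⟩)
  -- Next to the root, `u` has distance at most `depth z + 1` to `z` even without the off-tree edge,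
  -- so dropping it saves `α` for at most `n`.
  have hnash := hs.le_of_edist_le hα hc huS (fun z => T.depth z + 1) <| by
    refine edist_le_of_potential _ fun z _ => ?_
    by_cases hzr : z = T.root
    · left
      have h1 : (Profile.graph (Function.update s u ((s u).erase x))).Adj u z := by
        have := (hadj u hur).symm
        rwa [hpr, ← hzr] at this
      rw [SimpleGraph.edist_eq_one_iff_adj.2 h1]
      exact_mod_cast (by omega : 1 ≤ T.depth z + 1)
    · exact Or.inr ⟨_, hadj z hzr, (by have := T.depth_par hzr; omega)⟩
  have h := hmin u
  rw [distSum_root, distSum] at h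
  push_cast at hnash
  rw [Finset.sum_add_distrib] at hnash
  simp only [Finset.sum_const, Finset.card_univ, nsmul_eq_mul, mul_one] at hnash
  have h' := le_of_mul_card_le (c := 0) (B := 1) (n := Fintype.card V) hα
    (Finset.card_erase_add_one hx).le le_rfl (by linarith)
  have : (0 : ℝ) ≤ Fintype.card V := by positivity
  linarith

/-- Otherwise `u` would buy two edges not leading to children: to its parent and to `x`. -/
theorem IsNash.mem_of_par {u x : V} (hx : x ∈ s u) (hux : T.offTree.Adj u x) :
    u ∈ s (T.par u) := by
  have hur := T.offTree_ne_root hc hux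
  rcases (Profile.graph_adj.1 (T.adj_par u hur)).2 with h | h
  · exact h
  · exfalso
    have hpp : T.par (T.par u) ≠ u := fun e => by
      have h1 := T.depth_par hur
      have h2 := T.depth_par_le (T.par u)
      rw [e] at h2
      omega
    exact hux.2.1 (hs.eq_of_not_child hα hα' hc hmin hur h hx hpp hux.2.2)

/-- After the parent of the buyer `u` of an off-tree edge exchanged the edge to `u` for the edge
to the root, the subtree below `u` is reached through the off-tree edge. -/
theorem IsNash.le_of_par_buy_root {u x : V} (hx : x ∈ s u) (hux : T.offTree.Adj u x)
    {S : Finset V} (hpS : T.par u ∉ S) (hrS : T.root ∈ S)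
    (hS : ∀ z ∈ s (T.par u), T.par z = T.par u → z ≠ u → z ∈ S) :
    α * (s (T.par u)).card + (T.desc (T.par u) \ T.desc u).card * (T.depth (T.par u) + 1) ≤
      α * S.card + 3 * Fintype.card V := by
  have hur := T.offTree_ne_root hc hux
  have hpr := hs.par_ne_root hα hα' hc hmin hx hux
  refine hs.le_of_buy_root T hα hc hmin hpr hpS hrS (T.desc u) (par_notMem_desc hur)
    (root_notMem_desc hc hur) (fun z hz hzr hzp => ?_) (fun z hz => ?_)
  · refine ⟨fun h => hz (mem_desc_of_par_mem h), adj_par_update hzr hzp fun h1 h2 => ?_⟩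
    exact hS z h1 h2 fun e => hz (e ▸ self_mem_desc)
  · by_cases hzu : z = u
    · subst hzu
      refine ⟨x, (Profile.adj_update_of_mem hs.1 (T.par_ne hur).symm hx).symm,
        Or.inr ⟨notMem_desc_of_offTree hc hux, T.depth_le_of_adj hc hux.1⟩⟩
    · have hzr : z ≠ T.root := fun e => root_notMem_desc hc hur (e ▸ hz)
      have hpz := par_mem_desc hz hzu
      refine ⟨T.par z, adj_par_update hzr ?_ ?_, Or.inl ⟨hpz, (T.depth_par hzr).le⟩⟩
      · rintro rfl
        exact par_notMem_desc hur hz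
      · intro _ h2
        exact absurd (h2 ▸ hpz) (par_notMem_desc hur)

/-- The parent of `u` could trade an edge to a non-child, together with the edge to `u`, for the
edge to the root, since `u` stays attached through `x`. -/
theorem IsNash.par_eq_par_of_mem {u x y : V} (hx : x ∈ s u) (hux : T.offTree.Adj u x)
    (hy : y ∈ s (T.par u)) : T.par y = T.par u := by
  by_contra hyp
  have hpr := hs.par_ne_root hα hα' hc hmin hx hux
  have hu := hs.mem_of_par hα hα' hc hmin hx hux
  have h := hs.le_of_par_buy_root hα hα' hc hmin hx hux
    (S := insert T.root (((s (T.par u)).erase u).erase y))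
    (by simp [hpr, hs.1 (T.par u)]) (Finset.mem_insert_self _ _)
    (fun z h1 h2 h3 => Finset.mem_insert_of_mem (Finset.mem_erase.2
      ⟨fun e => hyp (e ▸ h2), Finset.mem_erase.2 ⟨h3, h1⟩⟩))
  have h' := le_of_mul_card_le hα
    (card_insert_erase_erase_le hu hy (fun e => hyp (by rw [e]))) (by positivity) h
  have : (0 : ℝ) ≤ Fintype.card V := by positivity
  linarith

theorem IsNash.card_desc_par_mul_le {u x : V} (hx : x ∈ s u) (hux : T.offTree.Adj u x) :
    (T.desc (T.par u) \ T.desc u).card * (T.depth (T.par u) + 1) ≤ 3 * Fintype.card V := by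
  have hpr := hs.par_ne_root hα hα' hc hmin hx hux
  have hu := hs.mem_of_par hα hα' hc hmin hx hux
  have h := hs.le_of_par_buy_root hα hα' hc hmin hx hux
    (S := insert T.root ((s (T.par u)).erase u))
    (by simp [hpr, hs.1 (T.par u)]) (Finset.mem_insert_self _ _)
    (fun z h1 h2 h3 => Finset.mem_insert_of_mem (Finset.mem_erase.2 ⟨h3, h1⟩))
  have h1 : α * ((insert T.root ((s (T.par u)).erase u)).card : ℝ) ≤ α * (s (T.par u)).card :=
    mul_le_mul_of_nonneg_left (by exact_mod_cast card_insert_erase_le hu) hα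
  have h2 : ((T.desc (T.par u) \ T.desc u).card : ℝ) * (T.depth (T.par u) + 1) ≤
      3 * Fintype.card V := by linarith
  exact_mod_cast h2

theorem IsNash.mem_of_par_par {u x : V} (hx : x ∈ s u) (hux : T.offTree.Adj u x) :
    T.par u ∈ s (T.par (T.par u)) := by
  have hpr := hs.par_ne_root hα hα' hc hmin hx hux
  rcases (Profile.graph_adj.1 (T.adj_par _ hpr)).2 with h | h
  · exact h
  · exfalso
    have h1 := hs.par_eq_par_of_mem hα hα' hc hmin hx hux h
    have h2 := T.depth_par hpr
    have h3 := T.depth_par_le (T.par (T.par u))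
    rw [h1] at h3
    omega

/-! ### Branching at buyers and at their parents -/

omit hmin in
/-- A bottleneck with few vertices and a moderate detour is impossible. -/
theorem IsNash.false_of_bottleneck {a q b : V} {W : Finset V} (ha : a ∉ W) (hb : b ∉ W)
    (hq : q ∈ W) (hab : a ≠ b) (haq : q ∈ s a) (hqb : b ∈ s q)
    (hW : ∀ z ∈ W, ∀ y ∉ W, s.graph.Adj z y → z = q ∧ (y = a ∨ y = b))
    (hcard : W.card * (T.depth q + 1) ≤ 3 * Fintype.card V)
    (hdel : ∀ z, (Profile.graph (Function.update s q ((s q).erase b))).edist q z ≤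
      (T.depth q + T.depth z + 2 : ℕ)) : False := by
  -- From `depth z ≤ depth q + dist q z`, the detour through the root costs at most `m = 2 (depth q
  -- + 1)` extra. With `hcard` this gives `α ≤ 2n + 4 · 3n = 14n`.
  have h := hs.le_of_bottleneck hα hc ha hb hq hab haq hqb hW (2 * (T.depth q + 1)) fun z => by
    refine (hdel z).trans ?_
    have h1 : s.graph.dist T.root z ≤ s.graph.dist T.root q + s.graph.dist q z :=
      hc.dist_triangle
    have h2 : T.depth q + T.depth z + 2 ≤ s.graph.dist q z + 2 * (T.depth q + 1) := by
      unfold depth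
      omega
    exact_mod_cast h2
  have h1 : (W.card : ℝ) * (T.depth q + 1) ≤ 3 * Fintype.card V := by exact_mod_cast hcard
  push_cast at h
  linarith

/-- Below the buyer of an off-tree edge, there are other edges leaving its subtree. -/
theorem IsNash.exists_other_exit {u x : V} (hx : x ∈ s u) (hux : T.offTree.Adj u x) :
    ∃ z ∈ T.desc u, ∃ y, T.offTree.Adj z y ∧ (z = u → y ≠ x) := by
  by_contra! hno
  have hur := T.offTree_ne_root hc hux
  have hpu := T.depth_par hur
  -- Otherwise only `par u → u` and `u → x` leave the subtree of `u`, and dropping the latter keeps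
  -- the tree.
  refine hs.false_of_bottleneck hα hα' hc (a := T.par u) (q := u) (b := x)
    (W := T.desc u) (par_notMem_desc hur) (notMem_desc_of_offTree hc hux) self_mem_desc
    hux.2.1 (hs.mem_of_par hα hα' hc hmin hx hux) hx (fun z hz y hy hzy => ?_)
    (hs.card_desc_mul_le hα hc hmin hur hx hux.2.2) ?_
  · by_cases h1 : T.par z = y
    · have hzu : z = u := by
        by_contra hzu
        exact hy (h1 ▸ par_mem_desc hz hzu)
      exact ⟨hzu, Or.inl (by rw [← h1, hzu])⟩
    · by_cases h2 : T.par y = z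
      · exact absurd (mem_desc_of_par_mem (h2 ▸ hz)) hy
      · obtain ⟨h3, h4⟩ := hno z hz y ⟨hzy, h1, h2⟩
        exact ⟨h3, Or.inr h4⟩
  · have hadj : ∀ z, z ≠ T.root →
        (Profile.graph (Function.update s u ((s u).erase x))).Adj (T.par z) z := fun z hz =>
      Profile.adj_update (T.adj_par z hz)
        (fun e h => Finset.mem_erase.2 ⟨fun e' => hux.2.2 (e' ▸ e), h⟩)
        (fun e h => Finset.mem_erase.2 ⟨fun e' => hux.2.1 (by rw [← e', e]), h⟩)
    have hroot : ∀ z, (Profile.graph (Function.update s u ((s u).erase x))).edist T.root z ≤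
        T.depth z :=
      edist_le_of_potential _ fun z hz => Or.inr ⟨_, hadj z hz, (T.depth_par hz).le⟩
    intro z
    calc _ ≤ _ := SimpleGraph.edist_triangle (v := T.root)
      _ ≤ (T.depth u : ℕ∞) + T.depth z :=
        add_le_add (by rw [SimpleGraph.edist_comm]; exact hroot u) (hroot z)
      _ ≤ _ := by exact_mod_cast (by omega : T.depth u + T.depth z ≤ T.depth u + T.depth z + 2)

/-- Below the parent of the buyer `u` of an off-tree edge, some off-tree edge has an end that is
not below `u`. -/
theorem IsNash.exists_exit_par {u x : V} (hx : x ∈ s u) (hux : T.offTree.Adj u x) :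
    ∃ z ∈ T.desc (T.par u), z ∉ T.desc u ∧ ∃ y, T.offTree.Adj z y := by
  by_contra! hno
  have hur := T.offTree_ne_root hc hux
  have hpr := hs.par_ne_root hα hα' hc hmin hx hux
  have hdu := T.depth_par hur
  have hdp := T.depth_par hpr
  have hpp : T.par (T.par u) ≠ u := fun e => by
    rw [e] at hdp
    omega
  -- Now the bottleneck is `par (par u) → par u → u`. Dropping its second edge leaves the subtree of
  -- `u` attached through `x`, at most two levels deeper.
  refine hs.false_of_bottleneck hα hα' hc (a := T.par (T.par u)) (q := T.par u) (b := u)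
    (W := T.desc (T.par u) \ T.desc u)
    (fun h => par_notMem_desc hpr (Finset.mem_sdiff.1 h).1)
    (fun h => (Finset.mem_sdiff.1 h).2 self_mem_desc)
    (Finset.mem_sdiff.2 ⟨self_mem_desc, par_notMem_desc hur⟩) hpp
    (hs.mem_of_par_par hα hα' hc hmin hx hux) (hs.mem_of_par hα hα' hc hmin hx hux)
    (fun z hz y hy hzy => ?_) (hs.card_desc_par_mul_le hα hα' hc hmin hx hux) ?_
  · rw [Finset.mem_sdiff] at hz
    by_cases h1 : T.par z = y
    · by_cases hzp : z = T.par u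
      · exact ⟨hzp, Or.inl (by rw [← h1, hzp])⟩
      · refine absurd (Finset.mem_sdiff.2 ⟨h1 ▸ par_mem_desc hz.1 hzp, fun h => hz.2 ?_⟩) hy
        exact mem_desc_of_par_mem (h1 ▸ h)
    · by_cases h2 : T.par y = z
      · have hyp : y ∈ T.desc (T.par u) := mem_desc_of_par_mem (h2 ▸ hz.1)
        have hyu : y ∈ T.desc u := by
          by_contra h
          exact hy (Finset.mem_sdiff.2 ⟨hyp, h⟩)
        have hyu' : y = u := by
          by_contra h
          exact hz.2 (h2 ▸ par_mem_desc hyu h)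
        exact ⟨by rw [← h2, hyu'], Or.inr hyu'⟩
      · exact absurd ⟨hzy, h1, h2⟩ (hno z hz.1 hz.2 y)
  · have hadj : ∀ z, z ≠ T.root → z ≠ u →
        (Profile.graph (Function.update s (T.par u) ((s (T.par u)).erase u))).Adj
          (T.par z) z := fun z hz hzu =>
      Profile.adj_update (T.adj_par z hz)
        (fun _ h => Finset.mem_erase.2 ⟨hzu, h⟩)
        (fun e h => Finset.mem_erase.2 ⟨fun e' => hpp (by rw [← e, e']), h⟩)
    have hroot : ∀ z, (Profile.graph (Function.update s (T.par u) ((s (T.par u)).erase u))).edist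
        T.root z ≤ ((if z ∈ T.desc u then T.depth z + 2 else T.depth z : ℕ) : ℕ∞) := by
      refine edist_le_of_potential _ fun z hz => Or.inr ?_
      by_cases hzu : z = u
      · subst hzu
        refine ⟨x, (Profile.adj_update_of_mem hs.1 (T.par_ne hur).symm hx).symm, ?_⟩
        have := T.depth_le_of_adj hc hux.1
        rw [if_neg (notMem_desc_of_offTree hc hux), if_pos self_mem_desc]
        omega
      · refine ⟨T.par z, hadj z hz hzu, ?_⟩
        have := T.depth_par hz
        by_cases hzd : z ∈ T.desc u
        · rw [if_pos hzd, if_pos (par_mem_desc hzd hzu)]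
          omega
        · rw [if_neg hzd, if_neg fun h => hzd (mem_desc_of_par_mem h)]
          omega
    intro z
    have h1 := hroot (T.par u)
    rw [if_neg (par_notMem_desc hur)] at h1
    calc _ ≤ _ := SimpleGraph.edist_triangle (v := T.root)
      _ ≤ (T.depth (T.par u) : ℕ∞) +
          ((if z ∈ T.desc u then T.depth z + 2 else T.depth z : ℕ) : ℕ∞) :=
        add_le_add (by rw [SimpleGraph.edist_comm]; exact h1) (hroot z)
      _ ≤ _ := by
        have h2 : T.depth (T.par u) + (if z ∈ T.desc u then T.depth z + 2 else T.depth z) ≤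
            T.depth (T.par u) + T.depth z + 2 := by
          split_ifs <;> omega
        exact_mod_cast h2

end

/-! ### The deviation of two players -/

/-- Buyers of off-tree edges are not parent and child, and not siblings. -/
theorem IsTwoCoalitionalNash.eq_of_close (hα : 0 ≤ α) (hα' : 14 * (Fintype.card V : ℝ) < α)
    (hs : IsTwoCoalitionalNash α s) (hc : s.graph.Connected)
    (hmin : ∀ v, distSum s.graph T.root ≤ distSum s.graph v) {u v x y : V}
    (hx : x ∈ s u) (hux : T.offTree.Adj u x) (hy : y ∈ s v) (hvy : T.offTree.Adj v y)
    (huv : u = T.par v ∨ T.par u = T.par v) : u = v := by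
  by_contra hne
  have hur := T.offTree_ne_root hc hux
  have hvr := T.offTree_ne_root hc hvy
  let S := insert T.root ((s u).erase x)
  have huS : u ∉ S := by simp [S, hur, hs.1.1 u]
  have hvS : v ∉ (s v).erase y := fun h => hs.1.1 v (Finset.mem_of_mem_erase h)
  let G' := Profile.graph (Function.update (Function.update s u S) v ((s v).erase y))
  have hadj : ∀ z, z ≠ T.root → G'.Adj (T.par z) z := by
    intro z hz
    have h1 : (Profile.graph (Function.update s u S)).Adj (T.par z) z :=
      Profile.adj_update (T.adj_par z hz)
        (fun e h => Finset.mem_insert_of_mem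
          (Finset.mem_erase.2 ⟨fun e' => hux.2.2 (e' ▸ e), h⟩))
        (fun e h => Finset.mem_insert_of_mem
          (Finset.mem_erase.2 ⟨fun e' => hux.2.1 (by rw [← e', e]), h⟩))
    refine Profile.adj_update h1 (fun e h => ?_) (fun e h => ?_)
    · rw [Function.update_of_ne (Ne.symm hne)] at h
      exact Finset.mem_erase.2 ⟨fun e' => hvy.2.2 (e' ▸ e), h⟩
    · rw [Function.update_of_ne (Ne.symm hne)] at h
      exact Finset.mem_erase.2 ⟨fun e' => hvy.2.1 (by rw [← e', e]), h⟩
  have hur' : G'.Adj u T.root := by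
    rw [Profile.graph_adj, Function.update_of_ne hne, Function.update_self]
    exact ⟨hur, Or.inl (Finset.mem_insert_self _ _)⟩
  have hf : ∀ z, G'.edist u z ≤ (T.depth z + 1 : ℕ) := by
    refine edist_le_of_potential (fun z => T.depth z + 1) fun z _ => ?_
    by_cases hzr : z = T.root
    · left
      rw [hzr, SimpleGraph.edist_eq_one_iff_adj.2 hur']
      exact_mod_cast (by omega : 1 ≤ T.depth T.root + 1)
    · exact Or.inr ⟨_, hadj z hzr, (by have := T.depth_par hzr; omega)⟩
  -- This closeness lets `v` share the root edge bought by `u`.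
  have hvu : G'.edist v u ≤ (2 : ℕ) := by
    have h1 := SimpleGraph.edist_eq_one_iff_adj.2 (hadj v hvr).symm
    rcases huv with h | h
    · rw [← h] at h1
      rw [h1]
      exact_mod_cast one_le_two
    · have h2 := SimpleGraph.edist_eq_one_iff_adj.2 (hadj u hur)
      calc G'.edist v u ≤ G'.edist v (T.par u) + G'.edist (T.par u) u :=
            SimpleGraph.edist_triangle
        _ = _ := by rw [h2, h, h1]; rfl
  have hg : ∀ z, G'.edist v z ≤ (T.depth z + 3 : ℕ) := fun z =>
    calc G'.edist v z ≤ G'.edist v u + G'.edist u z := SimpleGraph.edist_triangle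
      _ ≤ ((2 : ℕ) : ℕ∞) + (T.depth z + 1 : ℕ) := add_le_add hvu (hf z)
      _ = _ := by exact_mod_cast (by omega : 2 + (T.depth z + 1) = T.depth z + 3)
  have h := hs.le_of_edist_le hα hc hne huS hvS _ _ hf hg
  have h1 := hmin u
  have h2 := hmin v
  rw [distSum_root, distSum] at h1 h2
  push_cast at h
  rw [Finset.sum_add_distrib, Finset.sum_add_distrib] at h
  simp only [Finset.sum_const, Finset.card_univ, nsmul_eq_mul, mul_one] at h
  have h3 : α * (S.card : ℝ) ≤ α * (s u).card :=
    mul_le_mul_of_nonneg_left (by exact_mod_cast card_insert_erase_le hx) hα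
  -- One purchase is saved; the distance sums grow by at most `n` for `u` and `3n` for `v`.
  have h4 := le_of_mul_card_le (c := 0) (B := 4) (n := Fintype.card V) hα
    (Finset.card_erase_add_one hy).le le_rfl (by linarith)
  have : (0 : ℝ) ≤ Fintype.card V := by positivity
  linarith

end NetworkCreation

/-! ### Counting branching vertices -/

namespace NetworkCreation

open ShortestPathTree

section Counting

variable {V : Type*} [Fintype V] {G : SimpleGraph V} (T : ShortestPathTree G)

open Classical in
/-- The vertices whose subtree contains an end of an off-tree edge. -/
noncomputable def ShortestPathTree.live : Finset V := {v | ∃ z ∈ T.desc v, ∃ y, T.offTree.Adj z y}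

variable {T}

theorem mem_live {v : V} : v ∈ T.live ↔ ∃ z ∈ T.desc v, ∃ y, T.offTree.Adj z y := by
  simp [live]

open Classical in
/-- The children with an end of an off-tree edge in their subtree. -/
noncomputable def ShortestPathTree.liveChildren (T : ShortestPathTree G) (v : V) : Finset V :=
  {w ∈ T.live.erase T.root | T.par w = v}

theorem mem_liveChildren {v w : V} :
    w ∈ T.liveChildren v ↔ w ≠ T.root ∧ w ∈ T.live ∧ T.par w = v := by
  simp [liveChildren, and_assoc]

theorem exists_liveChild {v z y : V} (hz : z ∈ T.desc v) (hzy : T.offTree.Adj z y) :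
    z = v ∨ ∃ c ∈ T.liveChildren v, z ∈ T.desc c := by
  rcases eq_or_exists_child hz with h | ⟨c, hc, hcv, hzc⟩
  · exact Or.inl h
  · exact Or.inr ⟨c, mem_liveChildren.2 ⟨hc, mem_live.2 ⟨z, hzc, y, hzy⟩, hcv⟩, hzc⟩

open Classical in
theorem one_le_of_mem_live {v : V} (hv : v ∈ T.live) :
    1 ≤ (T.liveChildren v).card + T.offTree.degree v := by
  obtain ⟨z, hz, y, hzy⟩ := mem_live.1 hv
  rcases exists_liveChild hz hzy with rfl | ⟨c, hc, -⟩
  · have := (T.offTree.degree_pos_iff_exists_adj z).2 ⟨y, hzy⟩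
    omega
  · have := Finset.card_pos.2 ⟨c, hc⟩
    omega

open Classical in
/-- A set of vertices in which branches of the tree or off-tree edges meet is smaller than twice
the number of off-tree edges. -/
theorem card_lt_two_mul_card_edgeFinset (Q : Finset V) (hQ : Q ⊆ T.live)
    (hT : T.live.Nonempty)
    (h2 : ∀ v ∈ Q, 2 ≤ (T.liveChildren v).card + T.offTree.degree v) :
    Q.card < 2 * T.offTree.edgeFinset.card := by
  have hroot : T.root ∈ T.live := by
    obtain ⟨v, hv⟩ := hT
    obtain ⟨z, -, y, hzy⟩ := mem_live.1 hv
    exact mem_live.2 ⟨z, mem_desc_root, y, hzy⟩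
  -- Parents of live vertices are live, so the live vertices form a subtree with one edge fewer than
  -- vertices.
  have hfib : (T.live.erase T.root).card = ∑ v ∈ T.live, (T.liveChildren v).card := by
    refine Finset.card_eq_sum_card_fiberwise (f := T.par) fun z hz => ?_
    obtain ⟨x, hx, y, hxy⟩ := mem_live.1 (Finset.mem_of_mem_erase hz)
    exact mem_live.2 ⟨x, desc_trans hx mem_desc_par, y, hxy⟩
  have hdeg : ∑ v ∈ T.live, T.offTree.degree v ≤ 2 * T.offTree.edgeFinset.card := by
    rw [← SimpleGraph.sum_degrees_eq_twice_card_edges]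
    exact Finset.sum_le_sum_of_subset (Finset.subset_univ _)
  have hsum : T.live.card + Q.card ≤
      ∑ v ∈ T.live, ((T.liveChildren v).card + T.offTree.degree v) := by
    calc T.live.card + Q.card = ∑ v ∈ T.live, (1 + if v ∈ Q then 1 else 0) := by
          rw [Finset.sum_add_distrib, Finset.sum_ite_mem, Finset.inter_eq_right.2 hQ]
          simp
      _ ≤ _ := Finset.sum_le_sum fun v hv => by
          split_ifs with h
          · exact h2 v h
          · exact one_le_of_mem_live hv
  rw [Finset.sum_add_distrib, ← hfib] at hsum
  have := Finset.card_erase_add_one hroot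
  omega

end Counting

variable {V : Type*} [Fintype V] [DecidableEq V] {α : ℝ} {s : Profile V}
  {T : ShortestPathTree s.graph}

section

variable (hα : 0 ≤ α) (hα' : 14 * (Fintype.card V : ℝ) < α) (hs : IsNash α s)
  (hc : s.graph.Connected) (hmin : ∀ v, distSum s.graph T.root ≤ distSum s.graph v)
include hα hα' hs hc hmin

open Classical in
theorem IsNash.two_le_of_buyer {u x : V} (hx : x ∈ s u) (hux : T.offTree.Adj u x) :
    2 ≤ (T.liveChildren u).card + T.offTree.degree u := by
  obtain ⟨z, hz, y, hzy, hne⟩ := hs.exists_other_exit hα hα' hc hmin hx hux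
  rcases exists_liveChild hz hzy with rfl | ⟨c, hcu, -⟩
  · have : 1 < T.offTree.degree z := by
      rw [← SimpleGraph.card_neighborFinset_eq_degree, Finset.one_lt_card]
      exact ⟨y, by simpa using hzy, x, by simpa using hux, hne rfl⟩
    omega
  · have h1 := (T.offTree.degree_pos_iff_exists_adj u).2 ⟨x, hux⟩
    have h2 := Finset.card_pos.2 ⟨c, hcu⟩
    omega

open Classical in
theorem IsNash.two_le_of_par_buyer {u x : V} (hx : x ∈ s u) (hux : T.offTree.Adj u x) :
    2 ≤ (T.liveChildren (T.par u)).card + T.offTree.degree (T.par u) := by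
  have hu : u ∈ T.liveChildren (T.par u) := mem_liveChildren.2
    ⟨T.offTree_ne_root hc hux, mem_live.2 ⟨u, self_mem_desc, x, hux⟩, rfl⟩
  obtain ⟨z, hz, hzu, y, hzy⟩ := hs.exists_exit_par hα hα' hc hmin hx hux
  rcases exists_liveChild hz hzy with h | ⟨c, hcu, hzc⟩
  · have h1 := (T.offTree.degree_pos_iff_exists_adj (T.par u)).2 ⟨y, h ▸ hzy⟩
    have h2 := Finset.card_pos.2 ⟨u, hu⟩
    omega
  · have : 1 < (T.liveChildren (T.par u)).card :=
      Finset.one_lt_card.2 ⟨u, hu, c, hcu, fun e => hzu (e ▸ hzc)⟩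
    omega

open Classical in
/-- Off-tree edges have different buyers. -/
theorem IsNash.card_edgeFinset_le :
    T.offTree.edgeFinset.card ≤
      (Finset.univ.filter fun u => ∃ x ∈ s u, T.offTree.Adj u x).card := by
  -- The off-tree edge bought by `u`, unique by `IsNash.eq_of_not_child`; the value `s(u, u)` at
  -- other vertices plays no role.
  let f : V → Sym2 V := fun u =>
    if h : ∃ x ∈ s u, T.offTree.Adj u x then s(u, h.choose) else s(u, u)
  have hf : ∀ a b, T.offTree.Adj a b → b ∈ s a → f a = s(a, b) := by
    intro a b hab hb
    have h : ∃ x ∈ s a, T.offTree.Adj a x := ⟨b, hb, hab⟩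
    have h1 : h.choose = b := hs.eq_of_not_child hα hα' hc hmin (T.offTree_ne_root hc hab)
      h.choose_spec.1 hb h.choose_spec.2.2.2 hab.2.2
    simp only [f, dif_pos h, h1]
  refine (Finset.card_le_card (t := (Finset.univ.filter fun u =>
    ∃ x ∈ s u, T.offTree.Adj u x).image f) fun e => ?_).trans Finset.card_image_le
  induction e using Sym2.ind with
  | _ a b =>
    intro he
    have hab : T.offTree.Adj a b := by simpa using he
    rcases (Profile.graph_adj.1 hab.1).2 with h | h
    · exact Finset.mem_image.2 ⟨a, by simpa using ⟨b, h, hab⟩, hf a b hab h⟩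
    · exact Finset.mem_image.2 ⟨b, by simpa using ⟨a, h, hab.symm⟩,
        (hf b a hab.symm h).trans Sym2.eq_swap⟩

end

theorem IsTwoCoalitionalNash.not_offTree_adj (hα : 0 ≤ α)
    (hα' : 14 * (Fintype.card V : ℝ) < α) (hs : IsTwoCoalitionalNash α s)
    (hc : s.graph.Connected) (hmin : ∀ v, distSum s.graph T.root ≤ distSum s.graph v) (x y : V) :
    ¬ T.offTree.Adj x y := by
  classical
  intro hxy
  let O : Finset V := Finset.univ.filter fun u => ∃ x ∈ s u, T.offTree.Adj u x
  have memO : ∀ u, u ∈ O ↔ ∃ x ∈ s u, T.offTree.Adj u x := fun u => by simp [O]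
  have hdisj : Disjoint O (O.image T.par) := by
    rw [Finset.disjoint_left]
    intro u hu hu'
    obtain ⟨v, hv, rfl⟩ := Finset.mem_image.1 hu'
    obtain ⟨a, ha, hua⟩ := (memO _).1 hu
    obtain ⟨b, hb, hvb⟩ := (memO _).1 hv
    exact T.par_ne (T.offTree_ne_root hc hvb)
      (hs.eq_of_close hα hα' hc hmin ha hua hb hvb (Or.inl rfl))
  have hinj : (O.image T.par).card = O.card := by
    refine Finset.card_image_of_injOn fun u hu v hv huv => ?_
    obtain ⟨a, ha, hua⟩ := (memO _).1 hu
    obtain ⟨b, hb, hvb⟩ := (memO _).1 hv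
    exact hs.eq_of_close hα hα' hc hmin ha hua hb hvb (Or.inr huv)
  -- Buyers and their parents are `2 * O.card` distinct branching vertices, and `O.card` is at least
  -- the number of off-tree edges.
  have hlt := card_lt_two_mul_card_edgeFinset (T := T) (O ∪ O.image T.par) (fun v hv => ?_)
    ⟨x, mem_live.2 ⟨x, self_mem_desc, y, hxy⟩⟩ (fun v hv => ?_)
  · rw [Finset.card_union_of_disjoint hdisj, hinj] at hlt
    have : T.offTree.edgeFinset.card ≤ O.card := hs.1.card_edgeFinset_le hα hα' hc hmin
    omega
  · rcases Finset.mem_union.1 hv with h | h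
    · obtain ⟨a, -, hva⟩ := (memO v).1 h
      exact mem_live.2 ⟨v, self_mem_desc, a, hva⟩
    · obtain ⟨u, hu, rfl⟩ := Finset.mem_image.1 h
      obtain ⟨a, -, hua⟩ := (memO u).1 hu
      exact mem_live.2 ⟨u, mem_desc_par, a, hua⟩
  · rcases Finset.mem_union.1 hv with h | h
    · obtain ⟨a, ha, hva⟩ := (memO v).1 h
      exact hs.1.two_le_of_buyer hα hα' hc hmin ha hva
    · obtain ⟨u, hu, rfl⟩ := Finset.mem_image.1 h
      obtain ⟨a, ha, hua⟩ := (memO u).1 hu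
      exact hs.1.two_le_of_par_buyer hα hα' hc hmin ha hua

end NetworkCreation

theorem mainTheorem2 {V : Type*} [Fintype V] [DecidableEq V] [Nonempty V] (α : ℝ)
    (hα : 41 * (Fintype.card V : ℝ) ≤ α) (s : NetworkCreation.Profile V)
    (hs : NetworkCreation.IsTwoCoalitionalNash α s) :
    s.graph.IsTree := by
  have hn : (0 : ℝ) < Fintype.card V := by exact_mod_cast Fintype.card_pos
  have hα₀ : 0 ≤ α := by linarith
  have hc := hs.1.connected hα₀
  obtain ⟨r, -, hr⟩ := Finset.exists_min_image Finset.univ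
    (NetworkCreation.distSum s.graph) Finset.univ_nonempty
  obtain ⟨T, rfl⟩ := NetworkCreation.ShortestPathTree.exists_root_eq hc r
  exact T.isTree_of_offTree_eq_bot hc
    (hs.not_offTree_adj hα₀ (by linarith) hc fun v => hr v (Finset.mem_univ v))
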